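/- For $0<u\le 1$ let $\zeta(s,u)$ denote the Hurwitz zeta function, i.e. the meromorphic continuation to $\mathbb{C}$ of $\sum_{n=0}^{\infty}(n+u)^{-s}$ ($\operatorname{Re}s>1$), whose only singularity is a simple pole at $s=1$; primes denote derivatives with respect to $s$. Let the generalised Stieltjes constants $\gamma_p(u)$, $p\ge 0$, be defined by the Laurent expansion $$\zeta(s,u)=\frac{1}{s-1}+\sum_{p=0}^{\infty}\frac{(-1)^p}{p!}\,\gamma_p(u)\,(s-1)^p$$ about $s=1$. Let $\gamma$ be Euler's constant and $\Gamma$ the gamma function. Then $$\gamma_2\!\left(\tfrac14\right)-\gamma_2\!\left(\tfrac34\right)=2\pi\left[\zeta''\!\left(0,\tfrac14\right)-\zeta''\!\left(0,\tfrac34\right)\right]-4\pi\left[\gamma+\log(8\pi)\right]\left[2\log\Gamma\!\left(\tfrac14\right)-\log\pi-\tfrac12\log 2\right]+\frac{\pi}{2}\left(2\left[\gamma+\log(8\pi)\right]^2+\frac{\pi^2}{6}\right).$$ -/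

import Mathlib

/-!
For `u ∈ (0, 1]` the Hurwitz zeta function `ζ(s, u)`, i.e. the meromorphic continuation of
`∑ n, (n + u) ^ (-s)`, is Mathlib's `HurwitzZeta.hurwitzZeta (u : UnitAddCircle) s`.
-/

/-- The regular part `ζ(s, a) - 1 / (s - 1)` of the Hurwitz zeta function at its pole `s = 1`,
extended to `s = 1` by its limit there. -/
noncomputable def hurwitzZetaRegularPart (a : UnitAddCircle) : ℂ → ℂ :=
  Function.update (fun s => HurwitzZeta.hurwitzZeta a s - 1 / (s - 1)) 1
    (Filter.limUnder (nhdsWithin (1 : ℂ) {1}ᶜ) (fun s => HurwitzZeta.hurwitzZeta a s - 1 / (s - 1)))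

/-- The generalised Stieltjes constant `γ_p(a)`: the number for which `(-1) ^ p / p! * γ_p(a)` is
the coefficient of `(s - 1) ^ p` in the Laurent expansion of `ζ(s, a)` about `s = 1`
(see `hasSum_stieltjesConstant`). -/
noncomputable def stieltjesConstant (p : ℕ) (a : UnitAddCircle) : ℂ :=
  (-1) ^ p * iteratedDeriv p (hurwitzZetaRegularPart a) 1

/-- The limit in the definition exists: the regular part is an entire function. -/
theorem differentiable_hurwitzZetaRegularPart (a : UnitAddCircle) :
    Differentiable ℂ (hurwitzZetaRegularPart a) := by
  rw [← differentiableOn_univ]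
  refine Complex.differentiableOn_update_limUnder_of_isLittleO Filter.univ_mem ?_ ?_
  · intro s hs
    have hs1 : s ≠ 1 := hs.2
    refine DifferentiableAt.differentiableWithinAt ?_
    refine (HurwitzZeta.differentiableAt_hurwitzZeta a hs1).sub ?_
    exact (differentiableAt_const _).div (differentiableAt_id.sub_const _) (sub_ne_zero.2 hs1)
  · have hne : ∀ᶠ s in nhdsWithin (1 : ℂ) {1}ᶜ, s ≠ 1 := self_mem_nhdsWithin
    set c : ℂ := HurwitzZeta.hurwitzZeta a 1 - 1 / (1 - 1)
    rw [Asymptotics.isLittleO_iff_tendsto' (hne.mono fun s hs h =>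
      absurd h (inv_ne_zero (sub_ne_zero.2 hs)))]
    have h1 : Filter.Tendsto (fun s : ℂ => (s - 1) * c) (nhdsWithin (1 : ℂ) {1}ᶜ) (nhds 0) := by
      have : Continuous fun s : ℂ => (s - 1) * c := by fun_prop
      simpa using (this.tendsto 1).mono_left nhdsWithin_le_nhds
    have h2 := ((HurwitzZeta.hurwitzZeta_residue_one a).sub_const 1).sub h1
    simp only [sub_self] at h2
    refine h2.congr' (hne.mono fun s hs => ?_)
    have := sub_ne_zero.2 hs
    field_simp

/-- The Laurent expansion of the Hurwitz zeta function about `s = 1`. -/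
theorem hasSum_stieltjesConstant (a : UnitAddCircle) {s : ℂ} (hs : s ≠ 1) :
    HasSum (fun p : ℕ => (-1) ^ p / (p.factorial : ℂ) * stieltjesConstant p a * (s - 1) ^ p)
      (HurwitzZeta.hurwitzZeta a s - 1 / (s - 1)) := by
  have h := Complex.hasSum_taylorSeries_of_entire (differentiable_hurwitzZetaRegularPart a) 1 s
  have e : hurwitzZetaRegularPart a s = HurwitzZeta.hurwitzZeta a s - 1 / (s - 1) :=
    Function.update_of_ne hs _ _
  rw [e] at h
  convert! h using 1
  ext p
  have hp : ((-1 : ℂ) ^ p) * (-1) ^ p = 1 := by rw [← mul_pow]; simp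
  simp only [stieltjesConstant, smul_eq_mul, div_eq_mul_inv]
  linear_combination ((p.factorial : ℂ)⁻¹ * iteratedDeriv p (hurwitzZetaRegularPart a) 1 *
    (s - 1) ^ p) * hp

open Filter Topology Complex HurwitzZeta

/-! The difference f(s) = ζ(s,1/4) - ζ(s,3/4) is entire, equals 4^s L(s) with L the Dirichlet series
of the odd character mod 4, and satisfies f(1-s) = q(s) f(s), where q is `quarterGammaFactor`. The
poles at s = 1 cancel, so the Stieltjes difference is f''(1). Comparing derivatives of orders 0, 1,
2 at s = 1 gives f(1), f'(1), f''(1) from f(0), f'(0), f''(0) and the 2-jet of q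
(`quarterGammaFactor_derivatives`), which needs Γ''(1) (`iteratedDeriv_two_Gamma_one`). The values
f(0) and f'(0) come from a second-difference series for L converging near 0
(`sinZeta_quarter_eq_secondDifference`); Euler's limit for Γ sums its derivative
(`deriv_sinZeta_quarter_zero`). -/

/-! ### Locally uniform convergence of the second-difference series. -/

/-- Second differences are controlled by the second derivative. -/
theorem norm_second_difference_le {φ φ' φ'' : ℝ → ℂ} {y h C : ℝ} (hh : 0 ≤ h)
    (h1 : ∀ t ∈ Set.Icc y (y + 2 * h), HasDerivAt φ (φ' t) t)
    (h2 : ∀ t ∈ Set.Icc y (y + 2 * h), HasDerivAt φ' (φ'' t) t)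
    (hC : ∀ t ∈ Set.Icc y (y + 2 * h), ‖φ'' t‖ ≤ C) :
    ‖φ y - 2 * φ (y + h) + φ (y + 2 * h)‖ ≤ C * h * h := by
  have key : ∀ t ∈ Set.Icc y (y + h), ‖φ' (t + h) - φ' t‖ ≤ C * h := fun t ht => by
    have hsub : ∀ x ∈ Set.Icc t (t + h), x ∈ Set.Icc y (y + 2 * h) := fun x hx =>
      ⟨ht.1.trans hx.1, by linarith [hx.2, ht.2]⟩
    have := norm_image_sub_le_of_norm_deriv_le_segment'
      (fun x hx => (h2 x (hsub x hx)).hasDerivWithinAt)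
      (fun x hx => hC x (hsub x ⟨hx.1, hx.2.le⟩)) (t + h) ⟨by linarith, le_rfl⟩
    simpa using this
  have hd : ∀ t ∈ Set.Icc y (y + h),
      HasDerivWithinAt (fun t => φ (t + h) - φ t) (φ' (t + h) - φ' t) (Set.Icc y (y + h)) t :=
    fun t ht =>
      (((h1 (t + h) ⟨by linarith [ht.1], by linarith [ht.2]⟩).comp_add_const t h).sub
        (h1 t ⟨ht.1, by linarith [ht.2]⟩)).hasDerivWithinAt
  have := norm_image_sub_le_of_norm_deriv_le_segment' hd
    (fun t ht => key t ⟨ht.1, ht.2.le⟩) (y + h) ⟨by linarith, le_rfl⟩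
  rw [add_sub_cancel_left] at this
  refine le_trans (le_of_eq ?_) this
  congr 1
  rw [show y + h + h = y + 2 * h by ring]
  ring

theorem hasDerivAt_ofReal_cpow_neg (s : ℂ) {t : ℝ} (ht : 0 < t) :
    HasDerivAt (fun t : ℝ => (t : ℂ) ^ (-s)) (-s * (t : ℂ) ^ (-(s + 1))) t := by
  have := (hasStrictDerivAt_cpow_const (x := (t : ℂ)) (c := -s)
    (Or.inl (by simpa using ht))).hasDerivAt.comp_ofReal
  convert this using 3
  ring

/-- The second difference `(4n+1)^(-s) - 2(4n+3)^(-s) + (4n+5)^(-s)`. -/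
noncomputable def oddPowSecondDifference (n : ℕ) (s : ℂ) : ℂ :=
  ((4 * n + 1 : ℝ) : ℂ) ^ (-s) - 2 * ((4 * n + 3 : ℝ) : ℂ) ^ (-s) + ((4 * n + 5 : ℝ) : ℂ) ^ (-s)

/-- A bounded convex region containing `0` and part of the half-plane of convergence. -/
def secondDifferenceRegion : Set ℂ := {s : ℂ | -(1 / 2) < s.re} ∩ Metric.ball 0 2

theorem isOpen_secondDifferenceRegion : IsOpen secondDifferenceRegion :=
  (isOpen_lt continuous_const continuous_re).inter Metric.isOpen_ball

theorem isPreconnected_secondDifferenceRegion : IsPreconnected secondDifferenceRegion :=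
  ((convex_halfSpace_re_gt _).inter (convex_ball _ _)).isPreconnected

theorem zero_mem_secondDifferenceRegion : (0 : ℂ) ∈ secondDifferenceRegion := by
  constructor <;> simp

theorem norm_oddPowSecondDifference_le (n : ℕ) {s : ℂ} (hs : s ∈ secondDifferenceRegion) :
    ‖oddPowSecondDifference n s‖ ≤ 24 * ((n + 1 : ℕ) : ℝ) ^ (-(3 / 2) : ℝ) := by
  have hn : (0 : ℝ) ≤ n := n.cast_nonneg
  have hs1 : -(1 / 2) < s.re := hs.1
  have hs2 : ‖s‖ < 2 := by simpa using hs.2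
  have hpos : ∀ t ∈ Set.Icc (4 * n + 1 : ℝ) (4 * n + 1 + 2 * 2), 0 < t := fun t ht => by
    linarith [ht.1]
  have := norm_second_difference_le (φ := fun t : ℝ => (t : ℂ) ^ (-s))
    (φ' := fun t : ℝ => -s * (t : ℂ) ^ (-(s + 1)))
    (φ'' := fun t : ℝ => -s * (-(s + 1) * (t : ℂ) ^ (-(s + 1 + 1))))
    (y := 4 * n + 1) (h := 2) (C := 6 * ((n + 1 : ℕ) : ℝ) ^ (-(3 / 2) : ℝ)) zero_le_two
    (fun t ht => hasDerivAt_ofReal_cpow_neg s (hpos t ht))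
    (fun t ht => (hasDerivAt_ofReal_cpow_neg (s + 1) (hpos t ht)).const_mul _) ?_
  · refine le_trans (le_of_eq ?_) (this.trans (le_of_eq (by ring)))
    rw [oddPowSecondDifference]
    norm_num [add_assoc]
  · intro t ht
    have h1 : (1 : ℝ) ≤ t := by linarith [ht.1]
    rw [norm_mul, norm_mul, norm_neg, norm_neg, norm_cpow_eq_rpow_re_of_pos (hpos t ht),
      ← mul_assoc]
    -- On the ball of radius 2 this is 2 · 3; the step h = 2 enters squared, whence the constant 24.
    have hb : ‖s‖ * ‖s + 1‖ ≤ 6 := by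
      have : ‖s + 1‖ ≤ 3 := (norm_add_le _ _).trans (by rw [norm_one]; linarith)
      nlinarith [norm_nonneg s, norm_nonneg (s + 1)]
    refine mul_le_mul hb ?_ (by positivity) (by norm_num)
    calc t ^ (-(s + 1 + 1)).re ≤ t ^ (-(3 / 2) : ℝ) :=
          Real.rpow_le_rpow_of_exponent_le h1 (by simp; linarith)
      _ ≤ ((n + 1 : ℕ) : ℝ) ^ (-(3 / 2) : ℝ) := by
          refine Real.rpow_le_rpow_of_nonpos (by positivity) ?_ (by norm_num)
          push_cast
          linarith [ht.1]

theorem summable_bound_oddPowSecondDifference :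
    Summable fun n : ℕ => 24 * ((n + 1 : ℕ) : ℝ) ^ (-(3 / 2) : ℝ) :=
  ((summable_nat_add_iff 1).2 (Real.summable_nat_rpow.2 (by norm_num))).mul_left 24

theorem hasDerivAt_cpow_neg_left {x : ℝ} (hx : 0 < x) (s : ℂ) :
    HasDerivAt (fun s : ℂ => (x : ℂ) ^ (-s)) (-(x : ℂ) ^ (-s) * Real.log x) s := by
  have h := (hasDerivAt_neg s).const_cpow (c := (x : ℂ)) (Or.inl (by exact_mod_cast hx.ne'))
  rw [ofReal_log hx.le]
  convert h using 1
  ring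

theorem hasDerivAt_oddPowSecondDifference (n : ℕ) (s : ℂ) :
    HasDerivAt (oddPowSecondDifference n)
      (-((4 * n + 1 : ℝ) : ℂ) ^ (-s) * Real.log (4 * n + 1)
        - 2 * (-((4 * n + 3 : ℝ) : ℂ) ^ (-s) * Real.log (4 * n + 3))
        + -((4 * n + 5 : ℝ) : ℂ) ^ (-s) * Real.log (4 * n + 5)) s :=
  ((hasDerivAt_cpow_neg_left (by positivity) s).sub
    ((hasDerivAt_cpow_neg_left (by positivity) s).const_mul 2)).add
    (hasDerivAt_cpow_neg_left (by positivity) s)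

theorem differentiableOn_tsum_oddPowSecondDifference :
    DifferentiableOn ℂ (fun s => ∑' n, oddPowSecondDifference n s) secondDifferenceRegion :=
  differentiableOn_tsum_of_summable_norm summable_bound_oddPowSecondDifference
    (fun n s _ => (hasDerivAt_oddPowSecondDifference n s).differentiableAt.differentiableWithinAt)
    isOpen_secondDifferenceRegion (fun n _ hs => norm_oddPowSecondDifference_le n hs)

/-! ### The odd L-function mod 4 and its continuation to 0. -/

theorem sin_two_pi_quarter_mul (n j : ℕ) :
    Real.sin (2 * Real.pi * (1 / 4 : ℝ) * ((j + 4 * n : ℕ) : ℝ)) = Real.sin (j * (Real.pi / 2)) := by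
  rw [← Real.sin_add_nat_mul_two_pi (j * (Real.pi / 2)) n]
  congr 1
  push_cast
  ring

theorem summable_four_mul_add_cpow_neg {s : ℂ} (hs : 1 < s.re) (j : ℕ) :
    Summable fun n : ℕ => ((4 * n + j : ℝ) : ℂ) ^ (-s) := by
  have h := (Complex.summable_one_div_nat_cpow.2 hs).comp_injective
    (i := fun n : ℕ => 4 * n + j) (fun a b hab => by simpa using hab)
  refine h.congr fun n => ?_
  simp [cpow_neg]

/-- `sinZeta` at `1/4` is the Dirichlet `L`-function of the odd character mod `4`. -/
theorem sinZeta_quarter_eq_tsum {s : ℂ} (hs : 1 < s.re) :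
    sinZeta ((1 / 4 : ℝ) : UnitAddCircle) s =
      (∑' n : ℕ, ((4 * n + 1 : ℝ) : ℂ) ^ (-s)) - ∑' n : ℕ, ((4 * n + 3 : ℝ) : ℂ) ^ (-s) := by
  have h := hasSum_nat_sinZeta (1 / 4) hs
  rw [← h.tsum_eq, Nat.sumByResidueClasses h.summable 4]
  have h3 : Real.sin (3 * (Real.pi / 2)) = -1 := by
    rw [show 3 * (Real.pi / 2) = Real.pi / 2 + Real.pi by ring, Real.sin_add_pi,
      Real.sin_pi_div_two]
  have e : (Finset.univ : Finset (ZMod 4)) = {0, 1, 2, 3} := rfl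
  have v0 : (0 : ZMod 4).val = 0 := rfl
  have v1 : (1 : ZMod 4).val = 1 := rfl
  have v2 : (2 : ZMod 4).val = 2 := rfl
  have v3 : (3 : ZMod 4).val = 3 := rfl
  rw [e, Finset.sum_insert (by decide), Finset.sum_insert (by decide),
    Finset.sum_insert (by decide), Finset.sum_singleton]
  simp only [sin_two_pi_quarter_mul, v0, v1, v2, v3]
  norm_num [h3, mul_div_cancel₀, neg_div, tsum_neg, cpow_neg, add_comm]
  ring

/-- For Re s > 1, pulling 4^s out of (n + 1/4)^(-s) and (n + 3/4)^(-s) matches the two series; both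
sides are entire. This turns the functional equation, which relates `hurwitzZetaOdd` to `sinZeta`,
into one for a single function. -/
theorem hurwitzZetaOdd_quarter (s : ℂ) :
    2 * hurwitzZetaOdd ((1 / 4 : ℝ) : UnitAddCircle) s =
      4 ^ s * sinZeta ((1 / 4 : ℝ) : UnitAddCircle) s := by
  have hL : Differentiable ℂ fun s => 2 * hurwitzZetaOdd ((1 / 4 : ℝ) : UnitAddCircle) s :=
    (differentiable_hurwitzZetaOdd _).const_mul 2
  have hR : Differentiable ℂ fun s : ℂ => 4 ^ s * sinZeta ((1 / 4 : ℝ) : UnitAddCircle) s :=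
    (differentiable_id.const_cpow (Or.inl (by norm_num))).mul (differentiableAt_sinZeta _)
  refine congrFun (AnalyticOnNhd.eq_of_eventuallyEq (z₀ := 2)
    (fun s _ => hL.analyticAt s) (fun s _ => hR.analyticAt s) ?_) s
  have hre : {s : ℂ | 1 < s.re} ∈ 𝓝 (2 : ℂ) :=
    (isOpen_lt continuous_const continuous_re).mem_nhds (by simp)
  filter_upwards [hre] with s hs
  have h := (hasSum_nat_hurwitzZetaOdd_of_mem_Icc (a := 1 / 4) (by norm_num) hs).mul_left 2
  rw [← h.tsum_eq, sinZeta_quarter_eq_tsum hs,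
    ← (by simpa using summable_four_mul_add_cpow_neg hs 1 :
      Summable fun n : ℕ => ((4 * n + 1 : ℝ) : ℂ) ^ (-s)).tsum_sub
      (by simpa using summable_four_mul_add_cpow_neg hs 3), ← tsum_mul_left]
  congr 1
  ext n
  have key : ∀ x : ℝ, 0 ≤ x → 1 / ((x : ℂ)) ^ s = 4 ^ s * ((4 * x : ℝ) : ℂ) ^ (-s) := by
    intro x hx
    have h4 : ((4 : ℝ) : ℂ) ^ s ≠ 0 := by
      simp [cpow_eq_zero_iff]
    rw [ofReal_mul, mul_cpow_ofReal_nonneg (by norm_num) hx, cpow_neg, cpow_neg, one_div]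
    rw [← mul_assoc, show (4 : ℂ) = ((4 : ℝ) : ℂ) by norm_num, mul_inv_cancel₀ h4, one_mul]
  have k1 := key (n + 1 / 4) (by positivity)
  have k2 := key (n + 3 / 4) (by positivity)
  rw [show 4 * ((n : ℝ) + 1 / 4) = 4 * n + 1 by ring] at k1
  rw [show 4 * ((n : ℝ) + 3 / 4) = 4 * n + 3 by ring] at k2
  rw [mul_sub, ← k1, ← k2]
  push_cast
  rw [show (n : ℂ) + 1 - 1 / 4 = n + 3 / 4 by ring]
  ring

/-- Averaging the series over 4n+1 with its own shift, 1 plus the series over 4n+5, produces second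
differences; analytic continuation extends the identity from Re s > 1. -/
theorem sinZeta_quarter_eq_secondDifference :
    Set.EqOn (sinZeta ((1 / 4 : ℝ) : UnitAddCircle))
      (fun s => 1 / 2 + 1 / 2 * ∑' n, oddPowSecondDifference n s) secondDifferenceRegion := by
  have hmem : (3 / 2 : ℂ) ∈ secondDifferenceRegion := by
    constructor <;> norm_num
  refine AnalyticOnNhd.eqOn_of_preconnected_of_eventuallyEq
    (fun s _ => (differentiableAt_sinZeta _).analyticAt s)
    (DifferentiableOn.analyticOnNhd ?_ isOpen_secondDifferenceRegion)
    isPreconnected_secondDifferenceRegion hmem ?_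
  · exact (differentiableOn_tsum_oddPowSecondDifference.const_mul _).const_add _
  have hre : {s : ℂ | 1 < s.re} ∈ 𝓝 (3 / 2 : ℂ) :=
    (isOpen_lt continuous_const continuous_re).mem_nhds (by norm_num)
  filter_upwards [hre] with s hs
  have s1 : Summable fun n : ℕ => ((4 * n + 1 : ℝ) : ℂ) ^ (-s) := by
    simpa using summable_four_mul_add_cpow_neg hs 1
  have s3 : Summable fun n : ℕ => ((4 * n + 3 : ℝ) : ℂ) ^ (-s) := by
    simpa using summable_four_mul_add_cpow_neg hs 3
  have s5 : Summable fun n : ℕ => ((4 * n + 5 : ℝ) : ℂ) ^ (-s) := by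
    simpa using summable_four_mul_add_cpow_neg hs 5
  have hsum : ∑' n : ℕ, ((4 * n + 1 : ℝ) : ℂ) ^ (-s) =
      1 + ∑' n : ℕ, ((4 * n + 5 : ℝ) : ℂ) ^ (-s) := by
    rw [s1.tsum_eq_zero_add]
    congr 1
    · simp
    · congr 1
      ext n
      congr 2
      push_cast
      ring
  simp only [oddPowSecondDifference]
  rw [sinZeta_quarter_eq_tsum hs, (s1.sub (s3.mul_left 2)).tsum_add s5, s1.tsum_sub (s3.mul_left 2),
    tsum_mul_left, hsum]
  ring

theorem sinZeta_quarter_zero : sinZeta ((1 / 4 : ℝ) : UnitAddCircle) 0 = 1 / 2 := by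
  rw [sinZeta_quarter_eq_secondDifference zero_mem_secondDifferenceRegion]
  -- At s = 0 every term is 1 - 2 + 1 = 0.
  norm_num [oddPowSecondDifference]

/-! ### The derivative at 0 through Euler's limit for Γ. -/

theorem log_gammaSeq_quarter_sub {N : ℕ} (hN : N ≠ 0) :
    Real.log (Real.GammaSeq (1 / 4) N) - Real.log (Real.GammaSeq (3 / 4) N) =
      -(1 / 2) * Real.log N +
        ∑ j ∈ Finset.range (N + 1), (Real.log (4 * j + 3) - Real.log (4 * j + 1)) := by
  have hN0 : (0 : ℝ) < N := by positivity
  have key : ∀ a : ℝ, 0 < a → Real.log (Real.GammaSeq a N) =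
      a * Real.log N + Real.log N.factorial -
        ∑ j ∈ Finset.range (N + 1), (Real.log (4 * j + 4 * a) - Real.log 4) := by
    intro a ha
    have hne : ∀ j ∈ Finset.range (N + 1), a + (j : ℝ) ≠ 0 := fun j _ => by positivity
    rw [Real.GammaSeq, Real.log_div (by positivity) (Finset.prod_ne_zero_iff.2 hne),
      Real.log_mul (by positivity) (by positivity), Real.log_rpow hN0, Real.log_prod hne]
    congr 1
    refine Finset.sum_congr rfl fun j _ => ?_
    rw [show 4 * (j : ℝ) + 4 * a = 4 * (a + j) by ring, Real.log_mul (by norm_num) (by positivity)]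
    ring
  rw [key _ (by norm_num), key _ (by norm_num)]
  norm_num [Finset.sum_sub_distrib]
  ring

theorem sum_log_secondDifference (N : ℕ) :
    ∑ n ∈ Finset.range N,
        (-Real.log (4 * n + 1) + 2 * Real.log (4 * n + 3) - Real.log (4 * n + 5)) =
      2 * ∑ n ∈ Finset.range N, (Real.log (4 * n + 3) - Real.log (4 * n + 1))
        - Real.log (4 * N + 1) := by
  induction N with
  | zero => simp
  | succ N ih =>
    rw [Finset.sum_range_succ, Finset.sum_range_succ, ih]
    push_cast
    rw [show 4 * ((N : ℝ) + 1) + 1 = 4 * N + 5 by ring]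
    ring

theorem tendsto_log_sub_log_four_mul_add :
    Tendsto (fun N : ℕ => Real.log N - Real.log (4 * N + 5)) atTop (𝓝 (-Real.log 4)) := by
  have h : Tendsto (fun N : ℕ => (4 : ℝ) + 5 / N) atTop (𝓝 (4 + 0)) :=
    tendsto_const_nhds.add (tendsto_const_div_atTop_nhds_zero_nat 5)
  rw [add_zero] at h
  refine ((Real.continuousAt_log (by norm_num)).tendsto.comp h).neg.congr' ?_
  filter_upwards [eventually_gt_atTop 0] with N hN
  have hN0 : (0 : ℝ) < N := by exact_mod_cast hN
  rw [Function.comp_apply, show (4 : ℝ) + 5 / N = (4 * N + 5) / N by field_simp,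
    Real.log_div (by positivity) hN0.ne']
  ring

theorem tendsto_sum_log_secondDifference :
    Tendsto (fun N : ℕ => ∑ n ∈ Finset.range N,
        (-Real.log (4 * n + 1) + 2 * Real.log (4 * n + 3) - Real.log (4 * n + 5))) atTop
      (𝓝 (2 * (Real.log (Real.Gamma (1 / 4)) - Real.log (Real.Gamma (3 / 4))) - Real.log 4)) := by
  -- `Real.GammaSeq a N` has N + 1 factors in its denominator, so the partial sums are shifted by
  -- one.
  rw [← tendsto_add_atTop_iff_nat 1]
  have hG : ∀ a : ℝ, 0 < a → Tendsto (fun N => Real.log (Real.GammaSeq a N)) atTop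
      (𝓝 (Real.log (Real.Gamma a))) := fun a ha =>
    (Real.continuousAt_log (Real.Gamma_pos_of_pos ha).ne').tendsto.comp
      (Real.GammaSeq_tendsto_Gamma a)
  have h := (((hG (1 / 4) (by norm_num)).sub (hG (3 / 4) (by norm_num))).const_mul 2).add
    tendsto_log_sub_log_four_mul_add
  rw [← sub_eq_add_neg] at h
  refine h.congr' ?_
  filter_upwards [eventually_ne_atTop 0] with N hN
  rw [sum_log_secondDifference, log_gammaSeq_quarter_sub hN]
  push_cast
  rw [show 4 * ((N : ℝ) + 1) + 1 = 4 * N + 5 by ring]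
  ring

theorem deriv_sinZeta_quarter_zero :
    deriv (sinZeta ((1 / 4 : ℝ) : UnitAddCircle)) 0 =
      ((Real.log (Real.Gamma (1 / 4)) - Real.log (Real.Gamma (3 / 4)) - Real.log 2 : ℝ) : ℂ) := by
  have hs := hasSum_deriv_of_summable_norm summable_bound_oddPowSecondDifference
    (fun n s _ => (hasDerivAt_oddPowSecondDifference n s).differentiableAt.differentiableWithinAt)
    isOpen_secondDifferenceRegion (fun n _ hs => norm_oddPowSecondDifference_le n hs)
    zero_mem_secondDifferenceRegion
  have hterm : ∀ n : ℕ, deriv (oddPowSecondDifference n) 0 =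
      ((-Real.log (4 * n + 1) + 2 * Real.log (4 * n + 3) - Real.log (4 * n + 5) : ℝ) : ℂ) := by
    intro n
    rw [(hasDerivAt_oddPowSecondDifference n 0).deriv, neg_zero, cpow_zero, cpow_zero, cpow_zero]
    push_cast
    ring
  simp only [hterm] at hs
  have hlim := (continuous_ofReal.tendsto _).comp tendsto_sum_log_secondDifference
  have heq := tendsto_nhds_unique hs.tendsto_sum_nat
    (hlim.congr fun N => by simp only [Function.comp_apply, ofReal_sum])
  have hnhds := isOpen_secondDifferenceRegion.mem_nhds zero_mem_secondDifferenceRegion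
  rw [(sinZeta_quarter_eq_secondDifference.eventuallyEq_of_mem hnhds).deriv_eq,
    deriv_const_add, deriv_const_mul _
      (differentiableOn_tsum_oddPowSecondDifference.differentiableAt hnhds), heq,
    show (4 : ℝ) = 2 ^ 2 by norm_num, Real.log_pow]
  push_cast
  ring

/-! ### The second derivative of Γ at 1. -/

theorem contDiffAt_Gamma_one {n : WithTop ℕ∞} : ContDiffAt ℂ n Gamma 1 := by
  have h : DifferentiableOn ℂ Gamma {s : ℂ | 0 < s.re} := fun s hs =>
    (differentiableAt_Gamma s fun m hm => by
      have h0 : 0 < s.re := hs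
      rw [hm] at h0
      simp at h0
      linarith [(m.cast_nonneg : (0 : ℝ) ≤ m)]).differentiableWithinAt
  exact ((h.analyticAt ((isOpen_lt continuous_const continuous_re).mem_nhds
    (by simp)))).contDiffAt

theorem iteratedDeriv_two_fun_mul {f g : ℂ → ℂ} {x : ℂ} (hf : ContDiffAt ℂ 2 f x)
    (hg : ContDiffAt ℂ 2 g x) : iteratedDeriv 2 (fun s => f s * g s) x =
      f x * iteratedDeriv 2 g x + 2 * deriv f x * deriv g x + iteratedDeriv 2 f x * g x := by
  rw [iteratedDeriv_fun_mul hf hg]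
  simp [Finset.sum_range_succ]

theorem Gamma_one_add_mul_Gamma_one_sub_mul_sin :
    (fun z : ℂ => Gamma (1 + z) * Gamma (1 - z) * sin (Real.pi * z)) =ᶠ[𝓝 0]
      fun z => Real.pi * z := by
  have hpi : (Real.pi : ℂ) ≠ 0 := by exact_mod_cast Real.pi_ne_zero
  have hd : HasDerivAt (fun z : ℂ => sin (Real.pi * z)) (Real.pi : ℂ) 0 := by
    simpa using ((hasDerivAt_id (0 : ℂ)).const_mul (Real.pi : ℂ)).csin
  have h := hd.eventually_ne (c := 0) hpi
  -- The zero of sin(πz) at 0 is isolated, so the reflection formula can be cleared of its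
  -- denominator nearby.
  rw [eventually_nhdsWithin_iff] at h
  filter_upwards [h] with z hz
  rcases eq_or_ne z 0 with rfl | h0
  · simp
  have hs := hz h0
  rw [add_comm 1 z, Gamma_add_one z h0, mul_assoc z, Gamma_mul_Gamma_one_sub, mul_assoc,
    div_mul_cancel₀ _ hs, mul_comm]

/-- The reflection formula makes P(z) sin(πz) linear near 0, with P(z) = Γ(1+z)Γ(1-z). Its third
derivative at 0 vanishes, and as P(0) = 1 and P'(0) = 0, this reads 3π P''(0) = π³. -/
theorem iteratedDeriv_two_Gamma_one :
    iteratedDeriv 2 Gamma 1 = (Real.eulerMascheroniConstant : ℂ) ^ 2 + Real.pi ^ 2 / 6 := by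
  have hpi : (Real.pi : ℂ) ≠ 0 := by exact_mod_cast Real.pi_ne_zero
  have hadd : ContDiffAt ℂ 3 (fun z : ℂ => Gamma (1 + z)) 0 :=
    ContDiffAt.comp 0 (by simpa using contDiffAt_Gamma_one) (by fun_prop)
  have hsub : ContDiffAt ℂ 3 (fun z : ℂ => Gamma (1 - z)) 0 :=
    ContDiffAt.comp 0 (by simpa using contDiffAt_Gamma_one) (by fun_prop)
  have hsin : ContDiffAt ℂ 3 (fun z : ℂ => sin (Real.pi * z)) 0 := by fun_prop
  have hP1 : deriv (fun z : ℂ => Gamma (1 + z) * Gamma (1 - z)) 0 = 0 := by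
    rw [deriv_fun_mul (hadd.differentiableAt (by norm_num)) (hsub.differentiableAt (by norm_num)),
      deriv_comp_const_add, deriv_comp_const_sub]
    simp
  have hP2 : iteratedDeriv 2 (fun z : ℂ => Gamma (1 + z) * Gamma (1 - z)) 0 =
      2 * iteratedDeriv 2 Gamma 1 - 2 * (Real.eulerMascheroniConstant : ℂ) ^ 2 := by
    rw [iteratedDeriv_two_fun_mul (hadd.of_le (by norm_num)) (hsub.of_le (by norm_num)),
      deriv_comp_const_add, deriv_comp_const_sub, iteratedDeriv_comp_const_add,
      iteratedDeriv_comp_const_sub]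
    simp [hasDerivAt_Gamma_one.deriv]
    ring
  have h3 := Gamma_one_add_mul_Gamma_one_sub_mul_sin.iteratedDeriv_eq 3
  rw [iteratedDeriv_fun_mul (hadd.mul hsub) hsin] at h3
  have hS : ∀ k, iteratedDeriv k (fun z : ℂ => sin (Real.pi * z)) 0 =
      Real.pi ^ k * iteratedDeriv k sin 0 := fun k => by
    rw [iteratedDeriv_comp_const_mul contDiff_sin]
    simp
  simp [Finset.sum_range_succ, hS, iteratedDeriv_succ', hP1, Nat.choose] at h3
  rw [show deriv (deriv fun z : ℂ => Gamma (1 + z) * Gamma (1 - z)) 0 =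
    2 * iteratedDeriv 2 Gamma 1 - 2 * (Real.eulerMascheroniConstant : ℂ) ^ 2 by
      rw [← hP2]; simp [iteratedDeriv_succ']] at h3
  have : (Real.pi : ℂ) * (6 * iteratedDeriv 2 Gamma 1 - 6 * (Real.eulerMascheroniConstant : ℂ) ^ 2
      - Real.pi ^ 2) = 0 := by
    linear_combination h3
  have := (mul_eq_zero.1 this).resolve_left hpi
  linear_combination this / 6

/-! ### The functional equation and the 2-jet of its factor at 1. -/

/-- The factor in the functional equation of the odd `L`-function mod `4`. -/
noncomputable def quarterGammaFactor (s : ℂ) : ℂ :=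
  4 * ((8 * Real.pi : ℝ) : ℂ) ^ (-s) * (Gamma s * sin (Real.pi / 2 * s))

theorem hurwitzZetaOdd_quarter_one_sub {s : ℂ} (hs : ∀ n : ℕ, s ≠ -n) :
    2 * hurwitzZetaOdd ((1 / 4 : ℝ) : UnitAddCircle) (1 - s) =
      quarterGammaFactor s * (2 * hurwitzZetaOdd ((1 / 4 : ℝ) : UnitAddCircle) s) := by
  rw [hurwitzZetaOdd_one_sub _ hs, hurwitzZetaOdd_quarter, quarterGammaFactor,
    show (8 * Real.pi : ℝ) = 4 * (2 * Real.pi) by ring, ofReal_mul 4,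
    mul_cpow_ofReal_nonneg (by norm_num) (by positivity), cpow_neg ((4 : ℝ) : ℂ),
    show (Real.pi : ℂ) / 2 * s = Real.pi * s / 2 by ring]
  have h4 : (4 : ℂ) ^ s ≠ 0 := by simp [cpow_eq_zero_iff]
  push_cast
  field_simp
  norm_num
  ring

theorem hasDerivAt_const_mul_cpow_neg (c s : ℂ) {x : ℝ} (hx : 0 < x) :
    HasDerivAt (fun s : ℂ => c * (x : ℂ) ^ (-s)) (-c * Real.log x * (x : ℂ) ^ (-s)) s := by
  convert! (hasDerivAt_cpow_neg_left hx s).const_mul c using 1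
  ring

theorem quarterGammaFactor_derivatives :
    quarterGammaFactor 1 = 1 / (2 * Real.pi) ∧
    deriv quarterGammaFactor 1 =
      -(1 / (2 * Real.pi)) * (Real.eulerMascheroniConstant + Real.log (8 * Real.pi)) ∧
    iteratedDeriv 2 quarterGammaFactor 1 = 1 / (2 * Real.pi) *
      (((Real.eulerMascheroniConstant : ℂ) + Real.log (8 * Real.pi)) ^ 2 - Real.pi ^ 2 / 12) ∧
    ContDiffAt ℂ 2 quarterGammaFactor 1 := by
  have hpi : (Real.pi : ℂ) ≠ 0 := by exact_mod_cast Real.pi_ne_zero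
  have h8 : 0 < 8 * Real.pi := by positivity
  set E : ℂ → ℂ := fun s => 4 * ((8 * Real.pi : ℝ) : ℂ) ^ (-s) with hE
  set S : ℂ → ℂ := fun s => sin (Real.pi / 2 * s) with hS
  have E1 : deriv E = fun s => -4 * Real.log (8 * Real.pi) * ((8 * Real.pi : ℝ) : ℂ) ^ (-s) :=
    funext fun s => (hasDerivAt_const_mul_cpow_neg 4 s h8).deriv
  have E2 : iteratedDeriv 2 E 1 =
      4 * Real.log (8 * Real.pi) ^ 2 * ((8 * Real.pi : ℝ) : ℂ) ^ (-1 : ℂ) := by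
    rw [iteratedDeriv_succ', iteratedDeriv_one, E1,
      (hasDerivAt_const_mul_cpow_neg _ 1 h8).deriv]
    ring
  have Ec : ContDiffAt ℂ 2 E 1 :=
    (Differentiable.contDiff fun s =>
      (hasDerivAt_const_mul_cpow_neg 4 s h8).differentiableAt).contDiffAt
  have Sc : ContDiffAt ℂ 2 S 1 := by fun_prop
  have S0 : S 1 = 1 := by simp [hS]
  have S1 : deriv S 1 = 0 := by
    simpa using ((hasDerivAt_id (1 : ℂ)).const_mul (Real.pi / 2 : ℂ)).csin.deriv
  have S2 : iteratedDeriv 2 S 1 = -(Real.pi / 2) ^ 2 := by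
    rw [hS, iteratedDeriv_comp_const_mul contDiff_sin]
    simp [iteratedDeriv_succ']
  have Gc : ContDiffAt ℂ 2 Gamma 1 := contDiffAt_Gamma_one
  have GS1 : deriv (fun s => Gamma s * S s) 1 = -Real.eulerMascheroniConstant := by
    rw [deriv_fun_mul (Gc.differentiableAt (by norm_num)) (Sc.differentiableAt (by norm_num)),
      S0, S1, hasDerivAt_Gamma_one.deriv]
    ring
  have GS2 : iteratedDeriv 2 (fun s => Gamma s * S s) 1 =
      (Real.eulerMascheroniConstant : ℂ) ^ 2 - Real.pi ^ 2 / 12 := by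
    rw [iteratedDeriv_two_fun_mul Gc Sc, S0, S1, S2, iteratedDeriv_two_Gamma_one, Gamma_one]
    ring
  have GSc : ContDiffAt ℂ 2 (fun s => Gamma s * S s) 1 := Gc.mul Sc
  have hq : quarterGammaFactor = fun s => E s * (Gamma s * S s) := rfl
  have hpow : ((8 * Real.pi : ℝ) : ℂ) ^ (-1 : ℂ) = 1 / (8 * Real.pi) := by
    rw [cpow_neg_one]
    push_cast
    rw [one_div]
  have E0 : E 1 = 1 / (2 * Real.pi) := by
    rw [hE]
    simp only [hpow]
    field_simp
    norm_num
  refine ⟨?_, ?_, ?_, Ec.mul GSc⟩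
  · rw [hq]
    simp only [E0, S0, Gamma_one, mul_one]
  · rw [hq, deriv_fun_mul (Ec.differentiableAt (by norm_num)) (GSc.differentiableAt (by norm_num)),
      GS1, E1, E0, S0, Gamma_one]
    simp only [hpow]
    field_simp
    ring
  · rw [hq, iteratedDeriv_two_fun_mul Ec GSc, GS1, GS2, E1, E2, E0, S0, Gamma_one]
    simp only [hpow]
    field_simp
    ring

/-! ### Reduction to the odd Hurwitz zeta function and conclusion. -/

theorem coe_three_quarters : ((3 / 4 : ℝ) : UnitAddCircle) = -((1 / 4 : ℝ) : UnitAddCircle) := by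
  rw [eq_neg_iff_add_eq_zero, ← AddCircle.coe_add, show (3 / 4 : ℝ) + 1 / 4 = 1 by norm_num]
  exact AddCircle.coe_period 1

theorem hurwitzZeta_quarter_sub (s : ℂ) :
    hurwitzZeta ((1 / 4 : ℝ) : UnitAddCircle) s - hurwitzZeta ((3 / 4 : ℝ) : UnitAddCircle) s =
      2 * hurwitzZetaOdd ((1 / 4 : ℝ) : UnitAddCircle) s := by
  rw [coe_three_quarters, hurwitzZetaOdd_eq]
  ring

theorem differentiable_two_mul_hurwitzZetaOdd (a : UnitAddCircle) :
    Differentiable ℂ fun s => 2 * hurwitzZetaOdd a s :=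
  (differentiable_hurwitzZetaOdd _).const_mul 2

/-- Away from s = 1 the polar terms cancel; continuity covers s = 1 without evaluating the limit
there. -/
theorem hurwitzZetaRegularPart_quarter_sub (s : ℂ) :
    hurwitzZetaRegularPart ((1 / 4 : ℝ) : UnitAddCircle) s
        - hurwitzZetaRegularPart ((3 / 4 : ℝ) : UnitAddCircle) s =
      2 * hurwitzZetaOdd ((1 / 4 : ℝ) : UnitAddCircle) s := by
  refine congrFun (Continuous.ext_on (s := {1}ᶜ) (dense_compl_singleton (1 : ℂ))
    ((differentiable_hurwitzZetaRegularPart _).sub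
      (differentiable_hurwitzZetaRegularPart _)).continuous
    (differentiable_two_mul_hurwitzZetaOdd _).continuous fun s hs => ?_) s
  have hs1 : s ≠ 1 := hs
  simp only [Pi.sub_apply, hurwitzZetaRegularPart, Function.update_of_ne hs1,
    ← hurwitzZeta_quarter_sub]
  ring

theorem stieltjesConstant_two_quarter_sub :
    stieltjesConstant 2 ((1 / 4 : ℝ) : UnitAddCircle)
        - stieltjesConstant 2 ((3 / 4 : ℝ) : UnitAddCircle) =
      iteratedDeriv 2 (fun s => 2 * hurwitzZetaOdd ((1 / 4 : ℝ) : UnitAddCircle) s) 1 := by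
  rw [← funext hurwitzZetaRegularPart_quarter_sub, iteratedDeriv_fun_sub
    (differentiable_hurwitzZetaRegularPart _).contDiff.contDiffAt
    (differentiable_hurwitzZetaRegularPart _).contDiff.contDiffAt]
  simp [stieltjesConstant]

theorem contDiffAt_hurwitzZeta_zero (a : UnitAddCircle) {n : WithTop ℕ∞} :
    ContDiffAt ℂ n (hurwitzZeta a) 0 := by
  have h : DifferentiableOn ℂ (hurwitzZeta a) {1}ᶜ := fun s hs =>
    (differentiableAt_hurwitzZeta a hs).differentiableWithinAt
  exact (h.analyticAt (isOpen_compl_singleton.mem_nhds (by simp))).contDiffAt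

theorem iteratedDeriv_two_hurwitzZeta_quarter_sub :
    iteratedDeriv 2 (hurwitzZeta ((1 / 4 : ℝ) : UnitAddCircle)) 0
        - iteratedDeriv 2 (hurwitzZeta ((3 / 4 : ℝ) : UnitAddCircle)) 0 =
      iteratedDeriv 2 (fun s => 2 * hurwitzZetaOdd ((1 / 4 : ℝ) : UnitAddCircle) s) 0 := by
  rw [← funext hurwitzZeta_quarter_sub, iteratedDeriv_fun_sub
    (contDiffAt_hurwitzZeta_zero _) (contDiffAt_hurwitzZeta_zero _)]

theorem log_Gamma_three_quarters :
    Real.log (Real.Gamma (3 / 4)) =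
      Real.log Real.pi + 1 / 2 * Real.log 2 - Real.log (Real.Gamma (1 / 4)) := by
  have h := Real.Gamma_mul_Gamma_one_sub (1 / 4)
  rw [show (1 : ℝ) - 1 / 4 = 3 / 4 by norm_num, mul_one_div, Real.sin_pi_div_four] at h
  have h' := congrArg Real.log h
  rw [Real.log_mul (Real.Gamma_pos_of_pos (by norm_num)).ne'
    (Real.Gamma_pos_of_pos (by norm_num)).ne', Real.log_div Real.pi_ne_zero (by positivity),
    Real.log_div (by positivity) (by norm_num), Real.log_sqrt (by norm_num)] at h'
  linarith

theorem two_mul_hurwitzZetaOdd_quarter_zero :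
    2 * hurwitzZetaOdd ((1 / 4 : ℝ) : UnitAddCircle) 0 = 1 / 2 := by
  rw [hurwitzZetaOdd_quarter, sinZeta_quarter_zero, cpow_zero, one_mul]

theorem deriv_two_mul_hurwitzZetaOdd_quarter_zero :
    deriv (fun s => 2 * hurwitzZetaOdd ((1 / 4 : ℝ) : UnitAddCircle) s) 0 =
      ((2 * Real.log (Real.Gamma (1 / 4)) - Real.log Real.pi - 1 / 2 * Real.log 2 : ℝ) : ℂ) := by
  have hpow : HasDerivAt (fun s : ℂ => (4 : ℂ) ^ s) ((Real.log 4 : ℝ) : ℂ) 0 := by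
    have h := (hasDerivAt_id (0 : ℂ)).const_cpow (c := 4) (Or.inl (by norm_num))
    have h4 : Complex.log 4 = ((Real.log 4 : ℝ) : ℂ) := by
      rw [ofReal_log (by norm_num), ofReal_ofNat]
    rw [id, cpow_zero, one_mul, mul_one, h4] at h
    exact h
  rw [funext hurwitzZetaOdd_quarter, deriv_fun_mul hpow.differentiableAt
    (differentiableAt_sinZeta _ 0), hpow.deriv, sinZeta_quarter_zero, deriv_sinZeta_quarter_zero,
    log_Gamma_three_quarters, show (4 : ℝ) = 2 ^ 2 by norm_num, Real.log_pow, cpow_zero]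
  push_cast
  norm_num
  ring

theorem mainTheorem2 :
    stieltjesConstant 2 ((1 / 4 : ℝ) : UnitAddCircle)
        - stieltjesConstant 2 ((3 / 4 : ℝ) : UnitAddCircle) =
      2 * (Real.pi : ℂ) *
          (iteratedDeriv 2 (HurwitzZeta.hurwitzZeta ((1 / 4 : ℝ) : UnitAddCircle)) 0
            - iteratedDeriv 2 (HurwitzZeta.hurwitzZeta ((3 / 4 : ℝ) : UnitAddCircle)) 0)
        - ((4 * Real.pi * (Real.eulerMascheroniConstant + Real.log (8 * Real.pi)) *
            (2 * Real.log (Real.Gamma (1 / 4)) - Real.log Real.pi - 1 / 2 * Real.log 2) : ℝ) : ℂ)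
        + ((Real.pi / 2 *
            (2 * (Real.eulerMascheroniConstant + Real.log (8 * Real.pi)) ^ 2
              + Real.pi ^ 2 / 6) : ℝ) : ℂ) := by
  have hpi : (Real.pi : ℂ) ≠ 0 := by exact_mod_cast Real.pi_ne_zero
  rw [stieltjesConstant_two_quarter_sub, iteratedDeriv_two_hurwitzZeta_quarter_sub]
  have hf0 := two_mul_hurwitzZetaOdd_quarter_zero
  have hf1 := deriv_two_mul_hurwitzZetaOdd_quarter_zero
  set f : ℂ → ℂ := fun s => 2 * hurwitzZetaOdd ((1 / 4 : ℝ) : UnitAddCircle) s with hf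
  change f 0 = 1 / 2 at hf0
  obtain ⟨q0, q1, q2, qc⟩ := quarterGammaFactor_derivatives
  have hfd : Differentiable ℂ f := differentiable_two_mul_hurwitzZetaOdd _
  have hfc : ContDiffAt ℂ 2 f 1 := hfd.contDiff.contDiffAt
  have hfe : (fun s => f (1 - s)) =ᶠ[𝓝 1] fun s => quarterGammaFactor s * f s := by
    filter_upwards [(isOpen_lt continuous_const continuous_re).mem_nhds
      (show (1 : ℂ) ∈ {s : ℂ | 0 < s.re} by simp)] with s hs
    refine hurwitzZetaOdd_quarter_one_sub fun n hn => ?_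
    have h0 : 0 < s.re := hs
    rw [hn] at h0
    simp at h0
    linarith [(n.cast_nonneg : (0 : ℝ) ≤ n)]
  have e0 := hfe.eq_of_nhds
  have e1 := hfe.deriv_eq
  have e2 := hfe.iteratedDeriv_eq 2
  rw [deriv_comp_const_sub, deriv_fun_mul (qc.differentiableAt (by norm_num)) (hfd 1), sub_self,
    q0, q1, hf1] at e1
  rw [iteratedDeriv_comp_const_sub, iteratedDeriv_two_fun_mul qc hfc, q0, q1, q2] at e2
  simp only [sub_self, hf0, q0] at e0
  -- Order 0 of the functional equation: 1/2 = f(1) / (2π).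
  have f1 : f 1 = Real.pi := by
    field_simp at e0
    linear_combination -e0
  simp only [sub_self, f1, even_two, Even.neg_pow, one_pow, one_smul] at e1 e2
  rw [e2]
  push_cast at e1 ⊢
  field_simp at e1 ⊢
  -- Order 1, `e1`, eliminates f'(1); the factor 288 comes from cleared denominators.
  linear_combination (-288 * ((Real.eulerMascheroniConstant : ℂ) + Real.log (8 * Real.pi))) * e1
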